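/- Let $d,N\in\mathbb N$ with $N\ge 2$, and let $B$ be a real invertible $d\times d$ matrix such that $B^{-1}$ has integer entries and $$(B^T)^{-1}\mathbf n\notin(-N,N)^d\qquad\text{for all }\mathbf n\in\mathbb Z^d\setminus\{\mathbf 0\}.$$ Let $\Omega\subset\mathbb Z^d$ be any collection of coset representatives of $\mathbb Z^d/(B^{-1}\mathbb Z^d)$, that is, $\mathbb Z^d$ is the disjoint union of the sets $B^{-1}\mathbb Z^d+\mathbf m$, $\mathbf m\in\Omega$. Let $$k(\mathbf j):=\sqrt{|\det B|}\left(\frac{4^{N-1}}{N\binom{2N-2}{N-1}}\right)^{d/2}\prod_{\ell=1}^d\sin^{N-1}(\pi j_\ell/N)\,\chi_{[0,N]^d}(\mathbf j),\qquad \mathbf j\in\mathbb Z^d.$$ Then $k\in\ell^2(\mathbb Z^d)$, and the discrete Gabor system $\{k_{\mathbf m,\mathbf n}\}_{\mathbf m\in\Omega,\,\mathbf n\in\mathbb Z^d}$ given by $$k_{\mathbf m,\mathbf n}(\mathbf j)=e^{2\pi i\,B\mathbf m\cdot\mathbf j}\,k(\mathbf j-\mathbf n),\qquad \mathbf j\in\mathbb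 Z^d,$$ is a tight frame for $\ell^2(\mathbb Z^d)$ with frame bound $1$, that is, $$\sum_{\mathbf m\in\Omega}\sum_{\mathbf n\in\mathbb Z^d}|\langle f,k_{\mathbf m,\mathbf n}\rangle|^2=\|f\|^2\qquad\text{for all } f\in\ell^2(\mathbb Z^d).$$ -/

import Mathlib

open scoped Matrix

/-- The integer vector `n`, regarded as a real vector. -/
def intVec {d : ℕ} (n : Fin d → ℤ) : Fin d → ℝ := fun l => (n l : ℝ)

/-- The Hilbert space `ℓ²(ℤᵈ)` of complex square-summable sequences. -/
abbrev EllTwo (d : ℕ) : Type := lp (fun _ : Fin d → ℤ => ℂ) 2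

/-- The family `(φ i)` is a tight frame for the Hilbert space `H` with frame bound `A > 0`:
`∑ i, |⟨f, φ i⟩|² = A ‖f‖²` for all `f`, the sum being convergent. -/
def IsTightFrame {ι H : Type*} [NormedAddCommGroup H] [InnerProductSpace ℂ H]
    (φ : ι → H) (A : ℝ) : Prop :=
  0 < A ∧ ∀ f : H, HasSum (fun i => ‖inner ℂ (φ i) f‖ ^ 2) (A * ‖f‖ ^ 2)

/-- The condition that `B^♯ n ∉ (-N, N)ᵈ` for all nonzero integer vectors `n`,
where `B^♯ = (Bᵀ)⁻¹`. -/
def LatticeCondition {d : ℕ} (N : ℕ) (B : Matrix (Fin d) (Fin d) ℝ) : Prop :=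
  ∀ n : Fin d → ℤ, n ≠ 0 →
    (Bᵀ)⁻¹ *ᵥ intVec n ∉ Set.univ.pi fun _ : Fin d => Set.Ioo (-(N : ℝ)) (N : ℝ)

/-- The subgroup `B⁻¹ ℤᵈ` of `ℤᵈ` (for a matrix `B` such that `B⁻¹` has integer entries). -/
def invLattice {d : ℕ} (B : Matrix (Fin d) (Fin d) ℝ) : AddSubgroup (Fin d → ℤ) where
  carrier := {x | ∃ p : Fin d → ℤ, intVec x = B⁻¹ *ᵥ intVec p}
  zero_mem' := ⟨0, by
    have h : intVec (0 : Fin d → ℤ) = 0 := by ext; simp [intVec]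
    rw [h, Matrix.mulVec_zero]⟩
  add_mem' := by
    rintro x y ⟨p, hp⟩ ⟨q, hq⟩
    have h : ∀ u v : Fin d → ℤ, intVec (u + v) = intVec u + intVec v := by
      intro u v; ext; simp [intVec]
    exact ⟨p + q, by rw [h, h, hp, hq, Matrix.mulVec_add]⟩
  neg_mem' := by
    rintro x ⟨p, hp⟩
    have h : ∀ u : Fin d → ℤ, intVec (-u) = -intVec u := by
      intro u; ext; simp [intVec]
    exact ⟨-p, by rw [h, h, hp, Matrix.mulVec_neg]⟩

/-- `Ω` is a collection of coset representatives of `ℤᵈ / B⁻¹ ℤᵈ`: every element of `ℤᵈ` is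
`g + ω` for exactly one pair `(g, ω)` with `g ∈ B⁻¹ ℤᵈ` and `ω ∈ Ω`. -/
def IsCosetRepresentatives {d : ℕ} (B : Matrix (Fin d) (Fin d) ℝ)
    (Ω : Set (Fin d → ℤ)) : Prop :=
  AddSubgroup.IsComplement (invLattice B : Set (Fin d → ℤ)) Ω

/-- The sequence `j ↦ e^{2 π i (B m) · j} c (j - n)`. -/
noncomputable def gaborSeq {d : ℕ} (B : Matrix (Fin d) (Fin d) ℝ) (c : (Fin d → ℤ) → ℂ)
    (m n : Fin d → ℤ) : (Fin d → ℤ) → ℂ := fun j =>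
  Complex.exp (2 * Real.pi * Complex.I * (((B *ᵥ intVec m) ⬝ᵥ intVec j : ℝ) : ℂ)) * c (j - n)

theorem memℓp_gaborSeq {d : ℕ} (B : Matrix (Fin d) (Fin d) ℝ) {c : (Fin d → ℤ) → ℂ}
    (hc : Memℓp c 2) (m n : Fin d → ℤ) : Memℓp (gaborSeq B c m n) 2 := by
  have h2 : (0 : ℝ) < (2 : ENNReal).toReal := by norm_num
  rw [memℓp_gen_iff h2] at hc ⊢
  have h := (Equiv.subRight n).summable_iff.mpr hc
  refine h.congr fun j => ?_
  have he : ‖Complex.exp (2 * Real.pi * Complex.I *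
      (((B *ᵥ intVec m) ⬝ᵥ intVec j : ℝ) : ℂ))‖ = 1 := by
    rw [show (2 * Real.pi * Complex.I * (((B *ᵥ intVec m) ⬝ᵥ intVec j : ℝ) : ℂ) : ℂ)
      = ((2 * Real.pi * ((B *ᵥ intVec m) ⬝ᵥ intVec j) : ℝ) : ℂ) * Complex.I by
        push_cast; ring]
    exact Complex.norm_exp_ofReal_mul_I _
  simp [gaborSeq, he]

/-- The discrete Gabor system generated by `c ∈ ℓ²(ℤᵈ)` and the matrix `B`, with translation
parameter `n ∈ ℤᵈ` and modulation parameter `m ∈ Ω`, as a family in `ℓ²(ℤᵈ)`. -/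
noncomputable def gaborSystem {d : ℕ} (B : Matrix (Fin d) (Fin d) ℝ) (Ω : Set (Fin d → ℤ))
    (c : EllTwo d) : Ω × (Fin d → ℤ) → EllTwo d := fun p =>
  ⟨gaborSeq B c p.1 p.2, memℓp_gaborSeq B (lp.memℓp c) p.1 p.2⟩

/-- The window `√|det B| (4^(N-1) / (N * C(2N-2, N-1)))^(d/2) ∏ sin^(N-1)(π x_ℓ / N) χ_{[0,N]ᵈ}(x)`
on `ℝᵈ`. -/
noncomputable def sineWindow {d : ℕ} (N : ℕ) (B : Matrix (Fin d) (Fin d) ℝ)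
    (x : Fin d → ℝ) : ℝ :=
  √|B.det| * ((4 : ℝ) ^ (N - 1) / (N * (Nat.choose (2 * N - 2) (N - 1) : ℝ))) ^ ((d : ℝ) / 2)
    * (∏ l, Real.sin (Real.pi * x l / N) ^ (N - 1))
    * (Set.univ.pi fun _ : Fin d => Set.Icc (0 : ℝ) (N : ℝ)).indicator (fun _ => (1 : ℝ)) x

/-- The samples of `sineWindow` at the points of `ℤᵈ`, as a complex sequence. -/
noncomputable def sampledWindow {d : ℕ} (N : ℕ) (B : Matrix (Fin d) (Fin d) ℝ) :
    (Fin d → ℤ) → ℂ := fun j => (sineWindow N B (intVec j) : ℂ)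

/-! For fixed `n`, the inner products with `f` are finite exponential sums over `n + [0, N)ᵈ`, where
`k` shifted by `n` lives. Two distinct points of this cube differ by a vector in `(-N, N)ᵈ`, so the
lattice condition makes their difference a nontrivial character of the finite group `ℤᵈ / B⁻¹ℤᵈ`,
and the characters are orthogonal (`sum_modulation_sub_eq_zero`). Parseval over `Ω` then removes all
cross terms, and summing over `n` gives `|Ω| ‖k‖² ‖f‖²`. The constant is `1` because `|Ω| = 1 / |det
B|` (`card_quotient_invLattice`) and `‖k‖² = |det B|`. The latter is the sine power sum
`sum_sin_pow`, which the window's normalization inverts. -/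

/-! ### Power sums of sines. -/

open Finset in
/-- The power sum of the `N`-th roots of unity attached to the exponent `k`. -/
theorem sum_exp_two_pi_div_pow (N : ℕ) (hN : N ≠ 0) (k : ℕ) :
    ∑ j ∈ range N, (Complex.exp (2 * Real.pi * Complex.I / N) ^ j) ^ k
      = if N ∣ k then (N : ℂ) else 0 := by
  have hζ := Complex.isPrimitiveRoot_exp N hN
  set ζ := Complex.exp (2 * Real.pi * Complex.I / N)
  simp_rw [← pow_mul, mul_comm _ k, pow_mul]
  split_ifs with h
  · simp [(hζ.pow_eq_one_iff_dvd k).2 h]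
  · have h1 : ζ ^ k ≠ 1 := fun h' => h ((hζ.pow_eq_one_iff_dvd k).1 h')
    rw [geom_sum_eq h1, ← pow_mul, mul_comm, pow_mul, hζ.pow_eq_one]
    simp

/-- Square `w - 1 = 2i sin x · e^{ix}`, where `w = e^{2ix}`. -/
theorem ofReal_sin_sq_eq (x : ℝ) :
    ((Real.sin x ^ 2 : ℝ) : ℂ) * (4 * Complex.exp (2 * x * Complex.I))
      = -(Complex.exp (2 * x * Complex.I) - 1) ^ 2 := by
  have h : Complex.exp (2 * x * Complex.I) = (Complex.cos x + Complex.sin x * Complex.I) ^ 2 := by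
    rw [← Complex.exp_mul_I, ← Complex.exp_nat_mul]
    push_cast; ring_nf
  have hsq := Complex.sin_sq_add_cos_sq (x : ℂ)
  have hI := Complex.I_sq
  have hw : Complex.exp (2 * x * Complex.I) - 1
      = 2 * Complex.I * Complex.sin x * (Complex.cos x + Complex.sin x * Complex.I) := by
    rw [h]
    linear_combination hsq - Complex.sin x ^ 2 * hI
  rw [hw, h]
  push_cast
  linear_combination (4 * Complex.sin x ^ 2 * (Complex.cos x + Complex.sin x * Complex.I) ^ 2) * hI

open Finset in
/-- The sum of `sin ^ (2 N - 2)` over the points `π j / N`. -/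
theorem sum_sin_pow (N : ℕ) (hN : 1 ≤ N) :
    ∑ j ∈ range N, Real.sin (Real.pi * j / N) ^ (2 * (N - 1))
      = N * (Nat.choose (2 * N - 2) (N - 1) : ℝ) / 4 ^ (N - 1) := by
  obtain ⟨M, rfl⟩ : ∃ M, N = M + 1 := ⟨N - 1, by omega⟩
  have hN0 : ((M + 1 : ℕ) : ℂ) ≠ 0 := by exact_mod_cast Nat.succ_ne_zero M
  set ζ := Complex.exp (2 * Real.pi * Complex.I / (M + 1 : ℕ)) with hζdef
  have hζ : ζ ^ (M + 1) = 1 := (Complex.isPrimitiveRoot_exp (M + 1) (by omega)).pow_eq_one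
  have key : ∀ j : ℕ, ((Real.sin (Real.pi * j / (M + 1 : ℕ)) ^ (2 * M) : ℝ) : ℂ) * (-4) ^ M
      = ∑ k ∈ range (2 * M + 1), (ζ ^ j) ^ (k + 1) * ((-1) ^ (2 * M - k) *
        ((2 * M).choose k : ℂ)) := by
    intro j
    have h := ofReal_sin_sq_eq (Real.pi * j / (M + 1 : ℕ))
    have hw : Complex.exp (2 * (Real.pi * j / (M + 1 : ℕ) : ℝ) * Complex.I) = ζ ^ j := by
      rw [hζdef, ← Complex.exp_nat_mul]
      congr 1
      push_cast
      ring
    rw [hw] at h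
    -- With `w = ζ ^ j`, the identity `w ^ (M + 1) = 1` replaces the factor `w ^ (-M)` by `w`, so
    -- only nonnegative powers occur.
    have hwM : (ζ ^ j) ^ M * ζ ^ j = 1 := by
      rw [← pow_succ, ← pow_mul, mul_comm, pow_mul, hζ, one_pow]
    have h' := congrArg (· ^ M * ζ ^ j) h
    simp only [mul_pow] at h'
    rw [pow_mul, Complex.ofReal_pow]
    calc _ = ((((Real.sin (Real.pi * j / (M + 1 : ℕ)) ^ 2 : ℝ) : ℂ) ^ M
              * (4 ^ M * (ζ ^ j) ^ M)) * ζ ^ j) * (-1) ^ M := by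
            rw [show (-4 : ℂ) = (-1) * 4 by norm_num, mul_pow]
            linear_combination (-(((Real.sin (Real.pi * j / (M + 1 : ℕ)) ^ 2 : ℝ) : ℂ) ^ M
              * 4 ^ M * (-1) ^ M)) * hwM
      _ = (ζ ^ j + -1) ^ (2 * M) * ζ ^ j := by
            rw [h', neg_pow, ← pow_mul, sub_eq_add_neg]
            have : ((-1 : ℂ) ^ M) * (-1) ^ M = 1 := by rw [← mul_pow]; simp
            linear_combination ((ζ ^ j + -1) ^ (2 * M) * ζ ^ j) * this
      _ = _ := by
            rw [add_pow, sum_mul]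
            exact sum_congr rfl fun k _ => by ring
  have hsum : ((∑ j ∈ range (M + 1), Real.sin (Real.pi * j / (M + 1 : ℕ)) ^ (2 * M) : ℝ) : ℂ)
      * (-4) ^ M = (M + 1 : ℕ) * ((-1) ^ M * ((2 * M).choose M : ℂ)) := by
    rw [Complex.ofReal_sum, sum_mul, sum_congr rfl fun j _ => key j, sum_comm]
    simp_rw [← sum_mul]
    -- The exponents `k + 1` run from `1` to `2M + 1`; the only multiple of `M + 1` among them is `M
    -- + 1` itself.
    rw [sum_eq_single M]
    · rw [sum_exp_two_pi_div_pow _ (by omega), if_pos dvd_rfl, show 2 * M - M = M by omega]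
    · intro k hk hkM
      rw [sum_exp_two_pi_div_pow _ (by omega), if_neg, zero_mul]
      rintro ⟨c, hc⟩
      have hk' := mem_range.1 hk
      rcases Nat.lt_or_ge c 2 with h2 | h2
      · interval_cases c <;> omega
      · nlinarith
    · intro h
      exact absurd (mem_range.2 (by omega)) h
  have hreal : (∑ j ∈ range (M + 1), Real.sin (Real.pi * j / (M + 1 : ℕ)) ^ (2 * M))
      * (-4) ^ M = (M + 1 : ℕ) * ((-1) ^ M * ((2 * M).choose M : ℝ)) := by
    exact_mod_cast hsum
  rw [show M + 1 - 1 = M by omega, show 2 * (M + 1) - 2 = 2 * M by omega, eq_div_iff (by positivity)]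
  rw [show (-4 : ℝ) = (-1) * 4 by norm_num, mul_pow] at hreal
  have h1 : ((-1 : ℝ) ^ M) * (-1) ^ M = 1 := by rw [← mul_pow]; simp
  linear_combination (-1) ^ M * hreal +
    ((M + 1 : ℕ) * ((2 * M).choose M : ℝ)
      - (∑ j ∈ range (M + 1), Real.sin (Real.pi * j / (M + 1 : ℕ)) ^ (2 * M)) * 4 ^ M) * h1

/-! ### Finite Parseval identity. -/

open ComplexConjugate in
/-- Parseval's identity for a finite set on which unimodular functions are orthogonal. -/
theorem sum_norm_sq_sum_of_orthogonal {ι X : Type*} [Fintype ι] (S : Finset X) (e : ι → X → ℂ)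
    (g : X → ℂ) (he : ∀ i x, ‖e i x‖ = 1)
    (horth : ∀ x ∈ S, ∀ y ∈ S, x ≠ y → ∑ i, e i x * conj (e i y) = 0) :
    ∑ i, ‖∑ x ∈ S, e i x * g x‖ ^ 2 = Fintype.card ι * ∑ x ∈ S, ‖g x‖ ^ 2 := by
  classical
  have hc : ∀ z : ℂ, ((‖z‖ ^ 2 : ℝ) : ℂ) = z * conj z := fun z => by
    rw [Complex.mul_conj, Complex.normSq_eq_norm_sq]
  apply Complex.ofReal_injective
  push_cast [-Complex.ofReal_pow]
  simp_rw [hc, map_sum, Finset.sum_mul_sum]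
  rw [Finset.sum_comm, Finset.mul_sum]
  refine Finset.sum_congr rfl fun x hx => ?_
  rw [Finset.sum_comm, Finset.sum_eq_single x]
  · have : ∀ i, e i x * g x * conj (e i x * g x) = g x * conj (g x) := fun i => by
      have h1 : e i x * conj (e i x) = 1 := by rw [← hc, he]; simp
      rw [map_mul]
      linear_combination (g x * conj (g x)) * h1
    simp only [this, Finset.sum_const, Finset.card_univ, nsmul_eq_mul]
  · intro y hy hyx
    have : ∀ i, e i x * g x * conj (e i y * g y) = e i x * conj (e i y) * (g x * conj (g y)) :=
      fun i => by rw [map_mul]; ring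
    simp_rw [this]
    rw [← Finset.sum_mul, horth x hx y hy hyx.symm, zero_mul]
  · exact fun h => absurd hx h

/-! ### The lattice and its index. -/

theorem intVec_add {d : ℕ} (u v : Fin d → ℤ) : intVec (u + v) = intVec u + intVec v := by
  ext; simp [intVec]

theorem intVec_sub {d : ℕ} (u v : Fin d → ℤ) : intVec (u - v) = intVec u - intVec v := by
  ext; simp [intVec]

theorem intVec_mulVec {d : ℕ} (A : Matrix (Fin d) (Fin d) ℤ) (p : Fin d → ℤ) :
    intVec (A *ᵥ p) = A.map (Int.cast : ℤ → ℝ) *ᵥ intVec p := by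
  ext i; simp [intVec, Matrix.mulVec, dotProduct]

theorem intVec_injective {d : ℕ} : Function.Injective (intVec (d := d)) := by
  intro u v h
  ext i
  exact Int.cast_injective (α := ℝ) (congrFun h i)

theorem invLattice_eq_range {d : ℕ} {B : Matrix (Fin d) (Fin d) ℝ}
    {A : Matrix (Fin d) (Fin d) ℤ} (hA : B⁻¹ = A.map (Int.cast : ℤ → ℝ)) :
    invLattice B = (LinearMap.range (Matrix.toLin' A)).toAddSubgroup := by
  ext x
  simp only [invLattice, AddSubgroup.mem_mk, hA, ← intVec_mulVec, intVec_injective.eq_iff]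
  simp [eq_comm]

/-- The image of an injective integer matrix `A` has index `|det A|`, and here `det A · det B = 1`.
-/
theorem card_quotient_invLattice {d : ℕ} {B : Matrix (Fin d) (Fin d) ℝ} (hB : IsUnit B)
    {A : Matrix (Fin d) (Fin d) ℤ} (hA : B⁻¹ = A.map (Int.cast : ℤ → ℝ)) :
    (Nat.card ((Fin d → ℤ) ⧸ invLattice B) : ℝ) * |B.det| = 1 := by
  have hdet : B.det ≠ 0 := ((Matrix.isUnit_iff_isUnit_det B).1 hB).ne_zero
  have hdA : ((A.det : ℤ) : ℝ) * B.det = 1 := by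
    have h1 : (A.map (Int.cast : ℤ → ℝ)).det = ((A.det : ℤ) : ℝ) :=
      ((Int.castRingHom ℝ).map_det A).symm
    rw [← h1, ← hA, Matrix.det_nonsing_inv, Ring.inverse_eq_inv', inv_mul_cancel₀ hdet]
  have hA0 : A.det ≠ 0 := by rintro h; simp [h] at hdA
  have hinj : Function.Injective (Matrix.toLin' A) := by
    exact Matrix.mulVec_injective_of_det_ne_zero hA0
  have hcard := Submodule.natAbs_det_equiv _ (LinearEquiv.ofInjective (Matrix.toLin' A) hinj)
  have hcomp : (LinearMap.range (Matrix.toLin' A)).subtype ∘ₗ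
      AddMonoidHom.toIntLinearMap (LinearEquiv.ofInjective (Matrix.toLin' A) hinj : (Fin d → ℤ) →+ _)
      = Matrix.toLin' A := by
    ext; rfl
  rw [hcomp, LinearMap.det_toLin'] at hcard
  have hq : Nat.card ((Fin d → ℤ) ⧸ invLattice B) = A.det.natAbs := by
    rw [invLattice_eq_range hA, hcard]
    rfl
  rw [hq, Nat.cast_natAbs, Int.cast_abs, ← abs_mul, hdA, abs_one]

theorem IsCosetRepresentatives.bijective {d : ℕ} {B : Matrix (Fin d) (Fin d) ℝ}
    {Ω : Set (Fin d → ℤ)} (hΩ : IsCosetRepresentatives B Ω) :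
    Function.Bijective fun m : Ω => (QuotientAddGroup.mk m.1 : (Fin d → ℤ) ⧸ invLattice B) := by
  constructor
  · intro a b h
    rw [QuotientAddGroup.eq] at h
    have := hΩ.1 (a₁ := (⟨_, h⟩, a)) (a₂ := (⟨0, zero_mem _⟩, b)) (by simp)
    exact (Prod.ext_iff.1 this).2
  · intro q
    induction q using QuotientAddGroup.induction_on with | H x =>
    obtain ⟨⟨g, w⟩, h⟩ := hΩ.2 x
    refine ⟨w, ?_⟩
    simp only at h ⊢
    rw [QuotientAddGroup.eq, ← h]
    simp

/-! ### Characters of the quotient and their orthogonality. -/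

/-- The character `j ↦ e^{2 π i (B m) · j}` occurring in the Gabor system. -/
noncomputable def modulation {d : ℕ} (B : Matrix (Fin d) (Fin d) ℝ) (m j : Fin d → ℤ) : ℂ :=
  Complex.exp (2 * Real.pi * Complex.I * (((B *ᵥ intVec m) ⬝ᵥ intVec j : ℝ) : ℂ))

theorem modulation_add_left {d : ℕ} (B : Matrix (Fin d) (Fin d) ℝ) (m m' j : Fin d → ℤ) :
    modulation B (m + m') j = modulation B m j * modulation B m' j := by
  simp only [modulation, ← Complex.exp_add, intVec_add, Matrix.mulVec_add, add_dotProduct]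
  push_cast; ring_nf

theorem norm_modulation {d : ℕ} (B : Matrix (Fin d) (Fin d) ℝ) (m j : Fin d → ℤ) :
    ‖modulation B m j‖ = 1 := by
  rw [modulation, show (2 * Real.pi * Complex.I * (((B *ᵥ intVec m) ⬝ᵥ intVec j : ℝ) : ℂ) : ℂ)
      = ((2 * Real.pi * ((B *ᵥ intVec m) ⬝ᵥ intVec j) : ℝ) : ℂ) * Complex.I by
        push_cast; ring]
  exact Complex.norm_exp_ofReal_mul_I _

open ComplexConjugate in
theorem modulation_sub_right {d : ℕ} (B : Matrix (Fin d) (Fin d) ℝ) (m j j' : Fin d → ℤ) :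
    modulation B m (j - j') = modulation B m j * conj (modulation B m j') := by
  simp only [modulation, ← Complex.exp_conj, ← Complex.exp_add, intVec_sub, dotProduct_sub]
  simp only [map_mul, Complex.conj_I, Complex.conj_ofReal, map_ofNat]
  push_cast; ring_nf

theorem modulation_eq_one_iff {d : ℕ} (B : Matrix (Fin d) (Fin d) ℝ) (m j : Fin d → ℤ) :
    modulation B m j = 1 ↔ ∃ z : ℤ, (B *ᵥ intVec m) ⬝ᵥ intVec j = z := by
  rw [modulation, Complex.exp_eq_one_iff]
  refine exists_congr fun z => ?_
  rw [mul_comm (z : ℂ), mul_right_inj' Complex.two_pi_I_ne_zero]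
  norm_cast

theorem modulation_of_mem_invLattice {d : ℕ} {B : Matrix (Fin d) (Fin d) ℝ} (hB : IsUnit B)
    {m : Fin d → ℤ} (hm : m ∈ invLattice B) (j : Fin d → ℤ) : modulation B m j = 1 := by
  rw [modulation_eq_one_iff]
  obtain ⟨p, hp⟩ := hm
  refine ⟨p ⬝ᵥ j, ?_⟩
  rw [hp, Matrix.mulVec_mulVec, Matrix.mul_nonsing_inv _ ((Matrix.isUnit_iff_isUnit_det B).1 hB),
    Matrix.one_mulVec]
  simp [intVec, dotProduct]

/-- If `t` is annihilated by all modulations then it lies in `(Bᵀ)⁻¹ ℤᵈ`. -/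
theorem exists_eq_of_forall_modulation_eq_one {d : ℕ} {B : Matrix (Fin d) (Fin d) ℝ}
    (hB : IsUnit B) {t : Fin d → ℤ} (ht : ∀ m, modulation B m t = 1) :
    ∃ q : Fin d → ℤ, intVec t = (Bᵀ)⁻¹ *ᵥ intVec q := by
  choose q hq using fun i => (modulation_eq_one_iff B (Pi.single i 1) t).1 (ht _)
  refine ⟨q, ?_⟩
  have h : intVec q = Bᵀ *ᵥ intVec t := by
    ext i
    have h1 : intVec (Pi.single i (1 : ℤ)) = Pi.single i (1 : ℝ) := by
      ext l
      by_cases h : l = i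
      · subst h; simp [intVec]
      · simp [intVec, h]
    rw [intVec, ← hq i, h1, Matrix.mulVec_single_one]
    rfl
  rw [h, Matrix.mulVec_mulVec, Matrix.nonsing_inv_mul, Matrix.one_mulVec]
  rw [Matrix.det_transpose]
  exact (Matrix.isUnit_iff_isUnit_det B).1 hB

/-- The character depends only on the coset of `m`, so translation by `m₀` permutes `Ω` and
multiplies the sum by a factor other than `1`. -/
theorem sum_modulation_eq_zero {d : ℕ} {B : Matrix (Fin d) (Fin d) ℝ} (hB : IsUnit B)
    {Ω : Set (Fin d → ℤ)} [Fintype Ω] (hΩ : IsCosetRepresentatives B Ω) {t m₀ : Fin d → ℤ}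
    (ht : modulation B m₀ t ≠ 1) : ∑ m : Ω, modulation B m t = 0 := by
  let e : Ω ≃ (Fin d → ℤ) ⧸ invLattice B := Equiv.ofBijective _ hΩ.bijective
  let σ : Ω ≃ Ω := e.trans ((Equiv.addLeft (m₀ : (Fin d → ℤ) ⧸ invLattice B)).trans e.symm)
  have hσ : ∀ m : Ω, modulation B (σ m) t = modulation B m₀ t * modulation B m t := by
    intro m
    have h : ((σ m : Fin d → ℤ) : (Fin d → ℤ) ⧸ invLattice B) = ((m₀ + m : Fin d → ℤ) : _) := by
      exact e.apply_symm_apply _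
    rw [QuotientAddGroup.eq] at h
    have := modulation_of_mem_invLattice hB h t
    rw [← modulation_add_left, ← mul_one (modulation B (σ m) t), ← this, ← modulation_add_left]
    congr 1
    abel
  have hs := Equiv.sum_comp σ fun m : Ω => modulation B m t
  simp_rw [hσ] at hs
  rw [← Finset.mul_sum] at hs
  by_contra hne
  exact ht (mul_right_cancel₀ hne (hs.trans (one_mul _).symm))

/-- The cube `[0, N)ᵈ` of integer points. -/
noncomputable def intCube (d N : ℕ) : Finset (Fin d → ℤ) := Fintype.piFinset fun _ => Finset.Ico (0 : ℤ) N

theorem sum_modulation_sub_eq_zero {d N : ℕ} {B : Matrix (Fin d) (Fin d) ℝ} (hB : IsUnit B)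
    (hlat : LatticeCondition N B)
    {Ω : Set (Fin d → ℤ)} [Fintype Ω] (hΩ : IsCosetRepresentatives B Ω) {s s' : Fin d → ℤ}
    (hs : s ∈ intCube d N) (hs' : s' ∈ intCube d N) (hne : s ≠ s') :
    ∑ m : Ω, modulation B m (s - s') = 0 := by
  by_cases h : ∀ m, modulation B m (s - s') = 1
  · exfalso
    obtain ⟨q, hq⟩ := exists_eq_of_forall_modulation_eq_one hB h
    have hq0 : q ≠ 0 := by
      rintro rfl
      have h0 : intVec (0 : Fin d → ℤ) = 0 := by ext; simp [intVec]
      rw [h0, Matrix.mulVec_zero, ← h0] at hq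
      exact hne (sub_eq_zero.1 (intVec_injective hq))
    refine hlat q hq0 ?_
    rw [← hq, intVec_sub]
    intro l _
    have h1 := Finset.mem_Ico.1 (Fintype.mem_piFinset.1 hs l)
    have h2 := Finset.mem_Ico.1 (Fintype.mem_piFinset.1 hs' l)
    have h3 : (-(N : ℤ)) < s l - s' l ∧ s l - s' l < N := by omega
    simp only [Pi.sub_apply, intVec, Set.mem_Ioo]
    exact_mod_cast h3
  · push Not at h
    obtain ⟨m₀, hm₀⟩ := h
    exact sum_modulation_eq_zero hB hΩ hm₀

/-! ### Support and energy of the window. -/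

theorem sampledWindow_eq_zero {d N : ℕ} (hN : 2 ≤ N) (B : Matrix (Fin d) (Fin d) ℝ)
    {j : Fin d → ℤ} (hj : j ∉ intCube d N) : sampledWindow N B j = 0 := by
  simp only [intCube, Fintype.mem_piFinset, Finset.mem_Ico, not_forall] at hj
  obtain ⟨l, hl⟩ := hj
  rw [sampledWindow, sineWindow]
  by_cases hlN : j l = N
  -- The indicator allows the face `j l = N`, but `sin π = 0` and the exponent `N - 1` is positive.
  · have hN0 : (N : ℝ) ≠ 0 := by positivity
    have : ∏ l, Real.sin (Real.pi * intVec j l / N) ^ (N - 1) = 0 := by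
      refine Finset.prod_eq_zero (Finset.mem_univ l) ?_
      rw [intVec, hlN, Int.cast_natCast, mul_div_assoc, div_self hN0, mul_one, Real.sin_pi,
        zero_pow (by omega)]
    rw [this]
    simp
  · rw [Set.indicator_of_notMem]
    · simp
    · intro h
      have := h l (Set.mem_univ l)
      simp only [intVec, Set.mem_Icc] at this
      have h' : 0 ≤ j l ∧ j l ≤ N := by exact_mod_cast this
      omega

theorem norm_sampledWindow_sq {d N : ℕ} (B : Matrix (Fin d) (Fin d) ℝ)
    {j : Fin d → ℤ} (hj : j ∈ intCube d N) : ‖sampledWindow N B j‖ ^ 2 = |B.det| *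
      ((4 : ℝ) ^ (N - 1) / (N * (Nat.choose (2 * N - 2) (N - 1) : ℝ))) ^ d *
      ∏ l, Real.sin (Real.pi * j l / N) ^ (2 * (N - 1)) := by
  simp only [intCube, Fintype.mem_piFinset, Finset.mem_Ico] at hj
  rw [sampledWindow, sineWindow, Complex.norm_real, Real.norm_eq_abs, sq_abs,
    Set.indicator_of_mem, mul_one, mul_pow, mul_pow, Real.sq_sqrt (abs_nonneg _),
    ← Finset.prod_pow]
  · congr 1
    · congr 1
      have hc : ∀ c : ℝ, 0 ≤ c → (c ^ ((d : ℝ) / 2)) ^ 2 = c ^ d := fun c hc => by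
        rw [← Real.rpow_mul_natCast hc, ← Real.rpow_natCast]
        norm_num
      exact hc _ (by positivity)
    · exact Finset.prod_congr rfl fun l _ => by rw [← pow_mul, mul_comm 2]; rfl
  · intro l _
    have h : 0 ≤ j l ∧ j l ≤ N := ⟨(hj l).1, (hj l).2.le⟩
    simp only [intVec, Set.mem_Icc]
    exact_mod_cast h

/-- The sum over the cube factors over coordinates, and each factor cancels one copy of the
normalizing constant. -/
theorem sum_norm_sampledWindow_sq {d N : ℕ} (hN : 1 ≤ N) (B : Matrix (Fin d) (Fin d) ℝ) :
    ∑ j ∈ intCube d N, ‖sampledWindow N B j‖ ^ 2 = |B.det| := by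
  rw [Finset.sum_congr rfl fun j hj => norm_sampledWindow_sq B hj, ← Finset.mul_sum, intCube,
    ← Finset.prod_univ_sum (fun _ => Finset.Ico (0 : ℤ) N)
      fun _ x => Real.sin (Real.pi * x / N) ^ (2 * (N - 1))]
  have h : ∑ x ∈ Finset.Ico (0 : ℤ) N, Real.sin (Real.pi * x / N) ^ (2 * (N - 1))
      = ∑ j ∈ Finset.range N, Real.sin (Real.pi * j / N) ^ (2 * (N - 1)) := by
    symm
    refine Finset.sum_nbij (fun j : ℕ => (j : ℤ)) ?_ ?_ ?_ ?_
    · intro j hj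
      simpa using hj
    · intro a _ b _ hab
      exact Nat.cast_injective hab
    · intro x hx
      have hx' := Finset.mem_Ico.1 (Finset.mem_coe.1 hx)
      exact ⟨x.toNat, by simp; omega, by simp; omega⟩
    · intro j _
      simp
  rw [h, sum_sin_pow N hN, Finset.prod_const, Finset.card_univ, Fintype.card_fin, mul_assoc,
    ← mul_pow]
  have hc : ((2 * N - 2).choose (N - 1) : ℝ) ≠ 0 := by
    exact_mod_cast (Nat.choose_pos (by omega)).ne'
  have hN0 : (N : ℝ) ≠ 0 := by positivity
  rw [div_mul_div_cancel₀ (by positivity), div_self (by positivity), one_pow, mul_one]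

/-! ### The frame identity. -/

theorem memℓp_of_eq_zero_of_notMem {X : Type*} {S : Finset X} {k : X → ℂ}
    (hk : ∀ x ∉ S, k x = 0) (p : ENNReal) : Memℓp k p := by
  refine Memℓp.of_exponent_ge (memℓp_zero ?_) zero_le
  exact S.finite_toSet.subset fun x hx => by
    by_contra h
    exact hx (hk x h)

open ComplexConjugate in
theorem inner_gaborSystem {d N : ℕ} (B : Matrix (Fin d) (Fin d) ℝ) (Ω : Set (Fin d → ℤ))
    (k : EllTwo d) (hk : ∀ j ∉ intCube d N, k j = 0) (f : EllTwo d) (m : Ω) (n : Fin d → ℤ) :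
    inner ℂ (gaborSystem B Ω k (m, n)) f
      = ∑ s ∈ intCube d N, conj (modulation B m (n + s)) * (conj (k s) * f (n + s)) := by
  rw [lp.inner_eq_tsum, ← (Equiv.addLeft n).tsum_eq, tsum_eq_sum (s := intCube d N)]
  · refine Finset.sum_congr rfl fun s _ => ?_
    simp only [gaborSystem, gaborSeq, RCLike.inner_apply, Equiv.coe_addLeft, add_sub_cancel_left,
      map_mul, modulation]
    ring
  · intro s hs
    simp [gaborSystem, gaborSeq, hk s hs]

open ComplexConjugate in
theorem sum_norm_inner_gaborSystem_sq {d N : ℕ} {B : Matrix (Fin d) (Fin d) ℝ} (hB : IsUnit B)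
    (hlat : LatticeCondition N B)
    {Ω : Set (Fin d → ℤ)} [Fintype Ω] (hΩ : IsCosetRepresentatives B Ω)
    (k : EllTwo d) (hk : ∀ j ∉ intCube d N, k j = 0) (f : EllTwo d) (n : Fin d → ℤ) :
    ∑ m : Ω, ‖inner ℂ (gaborSystem B Ω k (m, n)) f‖ ^ 2
      = Fintype.card Ω * ∑ s ∈ intCube d N, ‖k s‖ ^ 2 * ‖f (n + s)‖ ^ 2 := by
  simp_rw [inner_gaborSystem B Ω k hk f]
  rw [sum_norm_sq_sum_of_orthogonal (intCube d N) (fun (m : Ω) s => conj (modulation B m (n + s)))]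
  · simp [mul_pow]
  · simp [norm_modulation]
  · intro s hs s' hs' hne
    -- Conjugation reverses the difference to `s' - s`, and the common shift `n` cancels.
    have h := sum_modulation_sub_eq_zero hB hlat hΩ hs' hs hne.symm
    rw [← h]
    refine Finset.sum_congr rfl fun m _ => ?_
    rw [← add_sub_add_left_eq_sub s' s n, modulation_sub_right, Complex.conj_conj, mul_comm]

/-- Nonnegativity turns the iterated sum, `n` outside and `m` inside, into an unconditional sum over
pairs. -/
theorem hasSum_prod_of_nonneg_of_fintype {α β : Type*} [Fintype α] {F : α × β → ℝ} {a : ℝ}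
    (hF : ∀ p, 0 ≤ F p) (h : HasSum (fun y => ∑ x, F (x, y)) a) : HasSum F a := by
  rw [← (Equiv.prodComm β α).hasSum_iff]
  have hs : Summable (F ∘ Equiv.prodComm β α) := by
    refine (summable_prod_of_nonneg fun _ => hF _).2 ⟨fun y => Summable.of_finite, ?_⟩
    simpa [tsum_fintype] using h.summable
  have h' := hs.hasSum
  rwa [(h'.prod_fiberwise fun y => hasSum_fintype _).unique h] at h'

/-- The frame identity for a window supported in `[0, N)ᵈ`: under the lattice condition the
discrete Gabor system is tight, with bound the index of the lattice times the energy of the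
window. -/
theorem hasSum_norm_inner_gaborSystem_sq {d N : ℕ} {B : Matrix (Fin d) (Fin d) ℝ} (hB : IsUnit B)
    (hlat : LatticeCondition N B)
    {Ω : Set (Fin d → ℤ)} [Fintype Ω] (hΩ : IsCosetRepresentatives B Ω)
    (k : EllTwo d) (hk : ∀ j ∉ intCube d N, k j = 0) (f : EllTwo d) :
    HasSum (fun p => ‖inner ℂ (gaborSystem B Ω k p) f‖ ^ 2)
      (Fintype.card Ω * (∑ s ∈ intCube d N, ‖k s‖ ^ 2) * ‖f‖ ^ 2) := by
  have hf : HasSum (fun j => ‖f j‖ ^ 2) (‖f‖ ^ 2) := by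
    have := lp.hasSum_norm (p := 2) (by norm_num) f
    simpa using this
  have hshift : ∀ s, HasSum (fun n => ‖f (n + s)‖ ^ 2) (‖f‖ ^ 2) := fun s =>
    (Equiv.hasSum_iff (f := fun j => ‖f j‖ ^ 2) (Equiv.addRight s)).2 hf
  have hn : HasSum (fun n => ∑ m : Ω, ‖inner ℂ (gaborSystem B Ω k (m, n)) f‖ ^ 2)
      (Fintype.card Ω * (∑ s ∈ intCube d N, ‖k s‖ ^ 2) * ‖f‖ ^ 2) := by
    -- Each `s` contributes `‖k s‖² ‖f‖²`, by translation invariance of the norm.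
    simp_rw [sum_norm_inner_gaborSystem_sq hB hlat hΩ k hk f, mul_assoc, Finset.sum_mul]
    exact (hasSum_sum fun s _ => (hshift s).mul_left _).mul_left _
  exact hasSum_prod_of_nonneg_of_fintype (fun _ => by positivity) hn

theorem corollary5p2 (d N : ℕ) (hN : 2 ≤ N) (B : Matrix (Fin d) (Fin d) ℝ) (hB : IsUnit B)
    (hint : ∀ i j, ∃ z : ℤ, B⁻¹ i j = (z : ℝ)) (hlat : LatticeCondition N B)
    (Ω : Set (Fin d → ℤ)) (hΩ : IsCosetRepresentatives B Ω) :
    ∃ hk : Memℓp (sampledWindow N B) 2,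
      IsTightFrame (gaborSystem B Ω ⟨sampledWindow N B, hk⟩) 1 := by
  have hzero : ∀ j ∉ intCube d N, sampledWindow N B j = 0 := fun j hj =>
    sampledWindow_eq_zero hN B hj
  refine ⟨memℓp_of_eq_zero_of_notMem hzero 2, one_pos, fun f => ?_⟩
  choose A hA using hint
  have hcard := card_quotient_invLattice hB (A := Matrix.of A) (by ext i j; exact hA i j)
  -- `Nat.card` of an infinite type is `0`, which the index identity rules out.
  have : Finite ((Fin d → ℤ) ⧸ invLattice B) := Nat.finite_of_card_ne_zero fun h => by
    simp [h] at hcard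
  let e : Ω ≃ (Fin d → ℤ) ⧸ invLattice B := Equiv.ofBijective _ hΩ.bijective
  have : Finite Ω := Finite.of_equiv _ e.symm
  have := Fintype.ofFinite Ω
  rw [← Nat.card_congr e, Nat.card_eq_fintype_card] at hcard
  have h := hasSum_norm_inner_gaborSystem_sq hB hlat hΩ
    ⟨sampledWindow N B, memℓp_of_eq_zero_of_notMem hzero 2⟩ hzero f
  rwa [show (∑ s ∈ intCube d N, ‖(⟨sampledWindow N B, memℓp_of_eq_zero_of_notMem hzero 2⟩ :
    EllTwo d) s‖ ^ 2) = |B.det| from sum_norm_sampledWindow_sq (by omega) B, hcard] at h
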